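/- Let $N\ge 2$ and let $\Omega\subseteq\mathbb R^N$ be a bounded domain with Lipschitz boundary. Let $p,q\in C(\overline\Omega)$ satisfy $1<p(x)<N$ and $p(x)<q(x)$ for all $x\in\overline\Omega$, and let $0\le\mu\in L^1(\Omega)$. Put $$\mathcal H(x,t)=t^{p(x)}+\mu(x)t^{q(x)}\quad(t\ge 0),\qquad \rho_{\mathcal H}(u)=\int_\Omega \mathcal H(x,|u(x)|)\,dx .$$ Let $L^{\mathcal H}(\Omega)$ be the space of (classes of) measurable functions $u$ on $\Omega$ such that $\rho_{\mathcal H}(\alpha u)<\infty$ for some $\alpha>0$, with the norm $\|u\|_{\mathcal H}=\inf\{\tau>0:\rho_{\mathcal H}(u/\tau)\le 1\}$. Let $W^{1,\mathcal H}(\Omega)$ be the space of all $u\in L^{\mathcal H}(\Omega)$ that have a weak gradient $\nabla u$ with $|\nabla u|\in L^{\mathcal H}(\Omega)$, with the norm $\|u\|_{1,\mathcal H}=\|u\|_{\mathcal H}+\|\,|\nabla u|\,\|_{\mathcal H}$, and let $W_0^{1,\mathcal H}(\Omega)$ be the closure of $C_0^\infty(\Omega)$ in $W^{1,\mathcal H}(\Omega)$.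 For $u,v\in W_0^{1,\mathcal H}(\Omega)$ consider $$I(u)=\int_\Omega\left(\frac{|\nabla u|^{p(x)}}{p(x)}+\mu(x)\frac{|\nabla u|^{q(x)}}{q(x)}\right)dx,$$ $$\langle A(u),v\rangle=\int_\Omega\left(|\nabla u|^{p(x)-2}\nabla u\cdot\nabla v+\mu(x)|\nabla u|^{q(x)-2}\nabla u\cdot\nabla v\right)dx .$$ Then the integrand of $I(u)$ is integrable for every $u\in W_0^{1,\mathcal H}(\Omega)$, so that $I\colon W_0^{1,\mathcal H}(\Omega)\to\mathbb R$ is well defined. Moreover, the integrand of $\langle A(u),v\rangle$ is integrable for all $u,v$, the functional $A(u)$ belongs to the dual space $W_0^{1,\mathcal H}(\Omega)^*$, and $I$ is of class $C^1$ with (Fréchet) derivative $I'(u)=A(u)$ for every $u\in W_0^{1,\mathcal H}(\Omega)$. -/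

import Mathlib

open MeasureTheory Set Filter Topology
open scoped NNReal ContDiff


namespace DoublePhase

/-! ## The standing hypothesis -/

/-- `Ω` has Lipschitz boundary: around every boundary point, in a suitable system of Cartesian
coordinates (the last axis is spanned by the unit vector `ν`, the others span its orthogonal
complement), `Ω` is the region strictly above the graph of a Lipschitz function `γ`. -/
def HasLipschitzBoundary {N : ℕ} (Ω : Set (EuclideanSpace ℝ (Fin N))) : Prop :=
  ∀ x ∈ frontier Ω, ∃ ν : EuclideanSpace ℝ (Fin N), ‖ν‖ = 1 ∧
    ∃ (K : ℝ≥0) (γ : (ℝ ∙ ν)ᗮ → ℝ), LipschitzWith K γ ∧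
      ∃ r > 0, ∀ y ∈ Metric.ball x r,
        y ∈ Ω ↔ γ ((ℝ ∙ ν)ᗮ.orthogonalProjectionOnto y) < inner ℝ ν y

/-- The standing hypothesis: `Ω ⊆ ℝ^N`, `N ≥ 2`, is a bounded domain with Lipschitz boundary,
`p, q` are continuous on the closure of `Ω` with `1 < p < N` and `p < q` there (so that also
`1 < q`), and `0 ≤ μ ∈ L¹(Ω)`. -/
structure Condition {N : ℕ} (Ω : Set (EuclideanSpace ℝ (Fin N)))
    (p q μ : EuclideanSpace ℝ (Fin N) → ℝ) : Prop where
  two_le : 2 ≤ N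
  isOpen : IsOpen Ω
  isConnected : IsConnected Ω
  isBounded : Bornology.IsBounded Ω
  lipschitzBoundary : HasLipschitzBoundary Ω
  continuousOn_p : ContinuousOn p (closure Ω)
  continuousOn_q : ContinuousOn q (closure Ω)
  one_lt_p : ∀ x ∈ closure Ω, 1 < p x
  p_lt : ∀ x ∈ closure Ω, p x < N
  p_lt_q : ∀ x ∈ closure Ω, p x < q x
  integrableOn_μ : IntegrableOn μ Ω
  μ_nonneg : ∀ᵐ x ∂(volume.restrict Ω), 0 ≤ μ x

/-! ## The Musielak-Orlicz space `L^H(Ω)` -/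

section Modular

variable {N : ℕ} (Ω : Set (EuclideanSpace ℝ (Fin N))) (p q μ : EuclideanSpace ℝ (Fin N) → ℝ)
  {F : Type*} [NormedAddCommGroup F] [NormedSpace ℝ F]

/-- The double phase function `H(x, t) = t ^ p(x) + μ(x) t ^ q(x)`. -/
noncomputable def phaseFun (x : EuclideanSpace ℝ (Fin N)) (t : ℝ) : ℝ :=
  t ^ p x + μ x * t ^ q x

/-- The modular `ρ_H(u) = ∫_Ω H(x, |u(x)|) dx`, with values in `[0, ∞]`. -/
noncomputable def modular (u : EuclideanSpace ℝ (Fin N) → F) : ENNReal :=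
  ∫⁻ x in Ω, ENNReal.ofReal (phaseFun p q μ x ‖u x‖)

/-- The Luxemburg norm `‖u‖_H = inf {τ > 0 : ρ_H(u / τ) ≤ 1}`. -/
noncomputable def luxNorm (u : EuclideanSpace ℝ (Fin N) → F) : ℝ :=
  sInf {τ : ℝ | 0 < τ ∧ modular Ω p q μ (fun x => τ⁻¹ • u x) ≤ 1}

/-- `ρ_H(α u) < ∞` for some `α > 0`. -/
def HasFiniteModular (u : EuclideanSpace ℝ (Fin N) → F) : Prop :=
  ∃ α : ℝ, 0 < α ∧ modular Ω p q μ (fun x => α • u x) < ⊤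

variable {Ω p q μ}

theorem modular_congr {u v : EuclideanSpace ℝ (Fin N) → F} (h : u =ᵐ[volume.restrict Ω] v) :
    modular Ω p q μ u = modular Ω p q μ v := by
  refine lintegral_congr_ae ?_
  filter_upwards [h] with x hx
  rw [hx]

theorem modular_smul_congr {u v : EuclideanSpace ℝ (Fin N) → F}
    (h : u =ᵐ[volume.restrict Ω] v) (c : ℝ) :
    modular Ω p q μ (fun x => c • u x) = modular Ω p q μ (fun x => c • v x) :=
  modular_congr (by filter_upwards [h] with x hx; rw [hx])

theorem luxNorm_congr {u v : EuclideanSpace ℝ (Fin N) → F} (h : u =ᵐ[volume.restrict Ω] v) :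
    luxNorm Ω p q μ u = luxNorm Ω p q μ v := by
  unfold luxNorm
  congr 1
  ext τ
  simp only [mem_ofPred_eq, modular_smul_congr h]

theorem HasFiniteModular.congr {u v : EuclideanSpace ℝ (Fin N) → F}
    (hu : HasFiniteModular Ω p q μ u) (h : u =ᵐ[volume.restrict Ω] v) :
    HasFiniteModular Ω p q μ v := by
  obtain ⟨α, hα, hf⟩ := hu
  exact ⟨α, hα, by rwa [← modular_smul_congr h]⟩

theorem modular_smul_of_norm (u : EuclideanSpace ℝ (Fin N) → F) {c d : ℝ} (h : |c| = |d|) :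
    modular Ω p q μ (fun x => c • u x) = modular Ω p q μ (fun x => d • u x) := by
  simp only [modular, norm_smul, Real.norm_eq_abs, h]

theorem luxNorm_nonneg (u : EuclideanSpace ℝ (Fin N) → F) : 0 ≤ luxNorm Ω p q μ u :=
  Real.sInf_nonneg fun _ hτ => hτ.1.le

theorem luxNorm_le {u : EuclideanSpace ℝ (Fin N) → F} {τ : ℝ} (hτ : 0 < τ)
    (h : modular Ω p q μ (fun x => τ⁻¹ • u x) ≤ 1) : luxNorm Ω p q μ u ≤ τ :=
  csInf_le ⟨0, fun _ hx => hx.1.le⟩ ⟨hτ, h⟩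

theorem luxNorm_smul_le_aux (u : EuclideanSpace ℝ (Fin N) → F) {c : ℝ} (hc : c ≠ 0) {τ : ℝ}
    (hτ : 0 < τ) (h : modular Ω p q μ (fun x => τ⁻¹ • u x) ≤ 1) :
    luxNorm Ω p q μ (fun x => c • u x) ≤ |c| * τ := by
  refine luxNorm_le (by positivity) ?_
  simp only [smul_smul]
  rwa [modular_smul_of_norm u (d := τ⁻¹)]
  have : |c| ≠ 0 := abs_ne_zero.2 hc
  simp only [abs_mul, abs_inv, abs_abs]
  field_simp

namespace Condition

theorem ae_bounds (h : Condition Ω p q μ) : ∀ᵐ x ∂(volume.restrict Ω), 1 < p x ∧ 1 < q x ∧ 0 ≤ μ x := by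
  filter_upwards [h.μ_nonneg, ae_restrict_mem h.isOpen.measurableSet] with x hμ hx
  have h1 := h.one_lt_p x (subset_closure hx)
  exact ⟨h1, h1.trans (h.p_lt_q x (subset_closure hx)), hμ⟩

theorem aemeasurable_phaseFun (h : Condition Ω p q μ) {u : EuclideanSpace ℝ (Fin N) → F}
    (hu : AEStronglyMeasurable u (volume.restrict Ω)) :
    AEMeasurable (fun x => phaseFun p q μ x ‖u x‖) (volume.restrict Ω) := by
  have hp : AEMeasurable p (volume.restrict Ω) :=
    (h.continuousOn_p.mono subset_closure).aemeasurable h.isOpen.measurableSet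
  have hq : AEMeasurable q (volume.restrict Ω) :=
    (h.continuousOn_q.mono subset_closure).aemeasurable h.isOpen.measurableSet
  have hμ : AEMeasurable μ (volume.restrict Ω) := h.integrableOn_μ.aemeasurable
  have hn : AEMeasurable (fun x => ‖u x‖) (volume.restrict Ω) := hu.norm.aemeasurable
  exact (hn.pow hp).add (hμ.mul (hn.pow hq))

theorem phaseFun_convex {x : EuclideanSpace ℝ (Fin N)} (hx : 1 < p x ∧ 1 < q x ∧ 0 ≤ μ x)
    {s t r a b : ℝ} (hr : 0 ≤ r) (hs : 0 ≤ s) (ht : 0 ≤ t) (ha : 0 ≤ a) (hb : 0 ≤ b)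
    (hab : a + b = 1) (hle : r ≤ a * s + b * t) :
    phaseFun p q μ x r ≤ a * phaseFun p q μ x s + b * phaseFun p q μ x t := by
  obtain ⟨hp, hq, hμ⟩ := hx
  have key : ∀ e : ℝ, 1 < e → r ^ e ≤ a * s ^ e + b * t ^ e := fun e he =>
    (Real.rpow_le_rpow hr hle (by linarith)).trans
      (by simpa using (convexOn_rpow he.le).2 (mem_Ici.2 hs) (mem_Ici.2 ht) ha hb hab)
  have h1 := key _ hp
  have h2 := mul_le_mul_of_nonneg_left (key _ hq) hμ
  unfold phaseFun
  linarith

theorem phaseFun_nonneg {x : EuclideanSpace ℝ (Fin N)} (hx : 1 < p x ∧ 1 < q x ∧ 0 ≤ μ x)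
    {t : ℝ} (ht : 0 ≤ t) : 0 ≤ phaseFun p q μ x t :=
  add_nonneg (Real.rpow_nonneg ht _) (mul_nonneg hx.2.2 (Real.rpow_nonneg ht _))

/-- Convexity of the modular. -/
theorem modular_convex (h : Condition Ω p q μ) {u v w : EuclideanSpace ℝ (Fin N) → F}
    (hu : AEStronglyMeasurable u (volume.restrict Ω)) {a b : ℝ} (ha : 0 ≤ a) (hb : 0 ≤ b)
    (hab : a + b = 1) (hw : ∀ x, w x = a • u x + b • v x) :
    modular Ω p q μ w ≤
      ENNReal.ofReal a * modular Ω p q μ u + ENNReal.ofReal b * modular Ω p q μ v := by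
  unfold modular
  rw [← lintegral_const_mul' _ _ ENNReal.ofReal_ne_top,
    ← lintegral_const_mul' _ _ ENNReal.ofReal_ne_top,
    ← lintegral_add_left' ((h.aemeasurable_phaseFun hu).ennreal_ofReal.const_mul _)]
  refine lintegral_mono_ae ?_
  filter_upwards [h.ae_bounds] with x hx
  rw [← ENNReal.ofReal_mul ha, ← ENNReal.ofReal_mul hb, ← ENNReal.ofReal_add
    (mul_nonneg ha (phaseFun_nonneg hx (norm_nonneg _)))
    (mul_nonneg hb (phaseFun_nonneg hx (norm_nonneg _)))]
  refine ENNReal.ofReal_le_ofReal (phaseFun_convex hx (norm_nonneg _) (norm_nonneg _)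
    (norm_nonneg _) ha hb hab ?_)
  rw [hw x]
  refine (norm_add_le _ _).trans ?_
  simp only [norm_smul, Real.norm_eq_abs, abs_of_nonneg ha, abs_of_nonneg hb, le_refl]

theorem modular_zero (h : Condition Ω p q μ) : modular Ω p q μ (fun _ => (0 : F)) = 0 := by
  unfold modular
  rw [lintegral_congr_ae (g := fun _ => 0), lintegral_zero]
  filter_upwards [h.ae_bounds] with x hx
  simp [phaseFun, Real.zero_rpow (by linarith : p x ≠ 0), Real.zero_rpow (by linarith : q x ≠ 0)]

/-- `ρ_H(c u) ≤ c ρ_H(u)` for `0 ≤ c ≤ 1`. -/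
theorem modular_smul_le (h : Condition Ω p q μ) (u : EuclideanSpace ℝ (Fin N) → F) {c : ℝ} (hc : 0 ≤ c) (hc1 : c ≤ 1) :
    modular Ω p q μ (fun x => c • u x) ≤ ENNReal.ofReal c * modular Ω p q μ u := by
  have := h.modular_convex (u := fun _ => (0 : F)) (v := u) (w := fun x => c • u x)
    aestronglyMeasurable_const (a := 1 - c) (b := c) (by linarith) hc (by ring) (by simp)
  simpa [h.modular_zero] using this

theorem luxNorm_set_nonempty (h : Condition Ω p q μ) {u : EuclideanSpace ℝ (Fin N) → F}
    (hu : HasFiniteModular Ω p q μ u) :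
    {τ : ℝ | 0 < τ ∧ modular Ω p q μ (fun x => τ⁻¹ • u x) ≤ 1}.Nonempty := by
  obtain ⟨α, hα, hf⟩ := hu
  set m := (modular Ω p q μ (fun x => α • u x)).toReal with hm
  have hm0 : 0 ≤ m := ENNReal.toReal_nonneg
  refine ⟨(m + 1) * α⁻¹, by positivity, ?_⟩
  have h1 := h.modular_smul_le (fun x => α • u x) (c := (m + 1)⁻¹) (by positivity)
    (inv_le_one_of_one_le₀ (by linarith))
  have h2 : (fun x => ((m + 1) * α⁻¹)⁻¹ • u x) = fun x => (m + 1)⁻¹ • α • u x := by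
    funext x; rw [smul_smul, mul_inv, inv_inv]
  rw [h2]
  refine h1.trans ?_
  rw [← ENNReal.ofReal_toReal (a := modular Ω p q μ (fun x => α • u x)) hf.ne, ← hm, ← ENNReal.ofReal_mul (by positivity),
    ENNReal.ofReal_le_one, inv_mul_le_iff₀ (by positivity)]
  linarith

theorem luxNorm_add_le (h : Condition Ω p q μ) {u v : EuclideanSpace ℝ (Fin N) → F}
    (hum : AEStronglyMeasurable u (volume.restrict Ω))
    (hu : HasFiniteModular Ω p q μ u) (hv : HasFiniteModular Ω p q μ v) :
    luxNorm Ω p q μ (fun x => u x + v x) ≤ luxNorm Ω p q μ u + luxNorm Ω p q μ v := by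
  refine le_of_forall_pos_le_add fun ε hε => ?_
  obtain ⟨s, ⟨hs, hs1⟩, hs2⟩ := Real.lt_sInf_add_pos (h.luxNorm_set_nonempty hu) (half_pos hε)
  obtain ⟨t, ⟨ht, ht1⟩, ht2⟩ := Real.lt_sInf_add_pos (h.luxNorm_set_nonempty hv) (half_pos hε)
  have hst : luxNorm Ω p q μ (fun x => u x + v x) ≤ s + t := by
    refine luxNorm_le (by positivity) ?_
    have hab : s / (s + t) + t / (s + t) = 1 := by field_simp
    refine (h.modular_convex (hum.const_smul s⁻¹) (v := fun x => t⁻¹ • v x)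
      (a := s / (s + t)) (b := t / (s + t)) (by positivity) (by positivity) hab ?_).trans ?_
    · intro x
      simp only [Pi.smul_apply, smul_smul, smul_add]
      congr 2 <;> field_simp
    · calc _ ≤ ENNReal.ofReal (s / (s + t)) * 1 + ENNReal.ofReal (t / (s + t)) * 1 := by
            gcongr
            exact hs1
        _ = 1 := by
            rw [mul_one, mul_one, ← ENNReal.ofReal_add (by positivity) (by positivity), hab,
              ENNReal.ofReal_one]
  have e1 : sInf {τ : ℝ | 0 < τ ∧ modular Ω p q μ (fun x => τ⁻¹ • u x) ≤ 1} =
    luxNorm Ω p q μ u := rfl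
  have e2 : sInf {τ : ℝ | 0 < τ ∧ modular Ω p q μ (fun x => τ⁻¹ • v x) ≤ 1} =
    luxNorm Ω p q μ v := rfl
  linarith

theorem luxNorm_smul_le (h : Condition Ω p q μ) {u : EuclideanSpace ℝ (Fin N) → F} (hu : HasFiniteModular Ω p q μ u)
    {c : ℝ} (hc : c ≠ 0) :
    luxNorm Ω p q μ (fun x => c • u x) ≤ |c| * luxNorm Ω p q μ u := by
  have hc' : 0 < |c| := abs_pos.2 hc
  rw [← div_le_iff₀' hc']
  refine le_csInf (h.luxNorm_set_nonempty hu) fun τ hτ => ?_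
  rw [div_le_iff₀' hc']
  exact luxNorm_smul_le_aux u hc hτ.1 hτ.2

theorem luxNorm_zero (h : Condition Ω p q μ) : luxNorm Ω p q μ (fun _ => (0 : F)) = 0 := by
  refine le_antisymm (le_of_forall_pos_le_add fun ε hε => ?_) (luxNorm_nonneg _)
  rw [zero_add]
  exact luxNorm_le hε (by simp [h.modular_zero])

theorem hasFiniteModular_smul {u : EuclideanSpace ℝ (Fin N) → F}
    (hu : HasFiniteModular Ω p q μ u) {c : ℝ} (hc : c ≠ 0) :
    HasFiniteModular Ω p q μ (fun x => c • u x) := by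
  obtain ⟨α, hα, hf⟩ := hu
  have hc' : 0 < |c| := abs_pos.2 hc
  refine ⟨α / |c|, by positivity, ?_⟩
  simp only [smul_smul]
  rwa [modular_smul_of_norm u (d := α)]
  rw [abs_mul, abs_div, abs_abs]
  field_simp

theorem hasFiniteModular_zero (h : Condition Ω p q μ) : HasFiniteModular Ω p q μ (fun _ => (0 : F)) :=
  ⟨1, one_pos, by simp [h.modular_zero]⟩

theorem hasFiniteModular_add (h : Condition Ω p q μ) {u v : EuclideanSpace ℝ (Fin N) → F}
    (hum : AEStronglyMeasurable u (volume.restrict Ω))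
    (hu : HasFiniteModular Ω p q μ u) (hv : HasFiniteModular Ω p q μ v) :
    HasFiniteModular Ω p q μ (fun x => u x + v x) := by
  obtain ⟨s, hs, hs1⟩ := h.luxNorm_set_nonempty hu
  obtain ⟨t, ht, ht1⟩ := h.luxNorm_set_nonempty hv
  refine ⟨(s + t)⁻¹, by positivity, ?_⟩
  have hab : s / (s + t) + t / (s + t) = 1 := by field_simp
  refine (h.modular_convex (hum.const_smul s⁻¹) (v := fun x => t⁻¹ • v x)
    (a := s / (s + t)) (b := t / (s + t)) (by positivity) (by positivity) hab ?_).trans_lt ?_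
  · intro x
    simp only [Pi.smul_apply, smul_smul, smul_add]
    congr 2 <;> field_simp
  · exact ENNReal.add_lt_top.2
      ⟨ENNReal.mul_lt_top ENNReal.ofReal_lt_top (hs1.trans_lt ENNReal.one_lt_top),
        ENNReal.mul_lt_top ENNReal.ofReal_lt_top (ht1.trans_lt ENNReal.one_lt_top)⟩

theorem luxNorm_smul (h : Condition Ω p q μ) {u : EuclideanSpace ℝ (Fin N) → F} (hu : HasFiniteModular Ω p q μ u)
    (c : ℝ) : luxNorm Ω p q μ (fun x => c • u x) = |c| * luxNorm Ω p q μ u := by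
  rcases eq_or_ne c 0 with rfl | hc
  · simp [h.luxNorm_zero]
  refine le_antisymm (h.luxNorm_smul_le hu hc) ?_
  have h1 := h.luxNorm_smul_le (hasFiniteModular_smul hu hc) (inv_ne_zero hc)
  simp only [smul_smul, inv_mul_cancel₀ hc, one_smul, abs_inv] at h1
  rwa [← le_inv_mul_iff₀ (abs_pos.2 hc)]

/-- Functions with finite modular are integrable over the bounded set `Ω`. -/
theorem integrable_of_hasFiniteModular (h : Condition Ω p q μ) {u : EuclideanSpace ℝ (Fin N) → F}
    (hum : AEStronglyMeasurable u (volume.restrict Ω)) (hu : HasFiniteModular Ω p q μ u) :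
    IntegrableOn u Ω := by
  obtain ⟨α, hα, hf⟩ := hu
  have hI : Integrable (fun x => phaseFun p q μ x ‖α • u x‖) (volume.restrict Ω) := by
    refine ⟨(h.aemeasurable_phaseFun (hum.const_smul α)).aestronglyMeasurable, ?_⟩
    rw [hasFiniteIntegral_iff_ofReal]
    · exact hf
    · filter_upwards [h.ae_bounds] with x hx using phaseFun_nonneg hx (norm_nonneg _)
  have hfin : volume Ω < ⊤ := h.isBounded.measure_lt_top
  have h1 : Integrable (fun _ : EuclideanSpace ℝ (Fin N) => (1 : ℝ)) (volume.restrict Ω) :=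
    integrableOn_const hfin.ne
  have h2 : Integrable (fun x => α • u x) (volume.restrict Ω) := by
    refine (h1.add hI).mono' (hum.const_smul α) ?_
    filter_upwards [h.ae_bounds] with x hx
    have hq : 0 ≤ μ x * ‖α • u x‖ ^ q x := mul_nonneg hx.2.2 (Real.rpow_nonneg (norm_nonneg _) _)
    simp only [Pi.add_apply, phaseFun]
    rcases le_total ‖α • u x‖ 1 with h3 | h3
    · have := Real.rpow_nonneg (norm_nonneg (α • u x)) (p x)
      linarith
    · have := Real.self_le_rpow_of_one_le h3 hx.1.le
      linarith
  have h3 := h2.smul α⁻¹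
  refine h3.congr (Eventually.of_forall fun x => ?_)
  simp [smul_smul, inv_mul_cancel₀ hα.ne']

theorem ae_eq_zero_of_luxNorm_eq_zero (h : Condition Ω p q μ) {u : EuclideanSpace ℝ (Fin N) → F}
    (hum : AEStronglyMeasurable u (volume.restrict Ω))
    (hu : HasFiniteModular Ω p q μ u) (h0 : luxNorm Ω p q μ u = 0) :
    u =ᵐ[volume.restrict Ω] 0 := by
  have hle : ∀ ε : ℝ, 0 < ε → ε ≤ 1 → modular Ω p q μ u ≤ ENNReal.ofReal ε := by
    intro ε hε hε1
    obtain ⟨τ, ⟨hτ, hτ1⟩, hτ2⟩ := Real.lt_sInf_add_pos (h.luxNorm_set_nonempty hu) hε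
    have e1 : sInf {τ : ℝ | 0 < τ ∧ modular Ω p q μ (fun x => τ⁻¹ • u x) ≤ 1} =
      luxNorm Ω p q μ u := rfl
    rw [e1, h0, zero_add] at hτ2
    have h2 := h.modular_smul_le (fun x => τ⁻¹ • u x) hτ.le (hτ2.le.trans hε1)
    simp only [smul_smul, mul_inv_cancel₀ hτ.ne', one_smul] at h2
    calc modular Ω p q μ u ≤ ENNReal.ofReal τ * 1 := h2.trans (by gcongr)
      _ ≤ ENNReal.ofReal ε := by rw [mul_one]; exact ENNReal.ofReal_le_ofReal hτ2.le
  have hz : modular Ω p q μ u = 0 := by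
    refine le_antisymm (ENNReal.le_of_forall_pos_le_add fun ε hε _ => ?_) zero_le
    have := hle (min ε 1) (lt_min hε one_pos) (min_le_right _ _)
    rw [zero_add]
    refine this.trans ((ENNReal.ofReal_le_ofReal (min_le_left _ _)).trans ?_)
    simp
  unfold modular at hz
  rw [lintegral_eq_zero_iff' (h.aemeasurable_phaseFun hum).ennreal_ofReal] at hz
  filter_upwards [hz, h.ae_bounds] with x hx hb
  simp only [Pi.zero_apply, ENNReal.ofReal_eq_zero, phaseFun] at hx
  have hq : 0 ≤ μ x * ‖u x‖ ^ q x := mul_nonneg hb.2.2 (Real.rpow_nonneg (norm_nonneg _) _)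
  have hp := Real.rpow_nonneg (norm_nonneg (u x)) (p x)
  have : ‖u x‖ ^ p x = 0 := by linarith
  simpa using ((Real.rpow_eq_zero (norm_nonneg _) (by linarith)).1 this)

end Condition

end Modular

/-! ### `L^H(Ω; F)` as a normed space -/

section Space

variable {N : ℕ} {Ω : Set (EuclideanSpace ℝ (Fin N))} {p q μ : EuclideanSpace ℝ (Fin N) → ℝ}

/-- The Musielak-Orlicz space `L^H(Ω; F)` of (classes of) measurable functions `u` on `Ω` with
`ρ_H(α u) < ∞` for some `α > 0`; `F = ℝ` gives `L^H(Ω)`, and `F = ℝ^N` is used for gradients. -/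
def LH (h : Condition Ω p q μ) (F : Type*) [NormedAddCommGroup F] [NormedSpace ℝ F] :
    Submodule ℝ (EuclideanSpace ℝ (Fin N) →ₘ[volume.restrict Ω] F) where
  carrier := {u | HasFiniteModular Ω p q μ u}
  zero_mem' := h.hasFiniteModular_zero.congr AEEqFun.coeFn_zero.symm
  add_mem' := fun {u v} hu hv =>
    (h.hasFiniteModular_add u.aestronglyMeasurable hu hv).congr (AEEqFun.coeFn_add u v).symm
  smul_mem' := fun c u hu => by
    rcases eq_or_ne c 0 with rfl | hc
    · rw [zero_smul]
      exact h.hasFiniteModular_zero.congr AEEqFun.coeFn_zero.symm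
    · exact (Condition.hasFiniteModular_smul hu hc).congr (AEEqFun.coeFn_smul c u).symm

variable {h : Condition Ω p q μ} {F : Type*} [NormedAddCommGroup F] [NormedSpace ℝ F]

noncomputable instance : Norm (LH h F) where
  norm u := luxNorm Ω p q μ (u : EuclideanSpace ℝ (Fin N) →ₘ[volume.restrict Ω] F)

theorem LH.norm_def (u : LH h F) : ‖u‖ =
    luxNorm Ω p q μ (u : EuclideanSpace ℝ (Fin N) →ₘ[volume.restrict Ω] F) := rfl

theorem LH.core : NormedSpace.Core ℝ (LH h F) where
  norm_nonneg u := luxNorm_nonneg _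
  norm_smul c u := by
    rw [LH.norm_def, LH.norm_def, Real.norm_eq_abs, ← h.luxNorm_smul u.2 c]
    exact luxNorm_congr (AEEqFun.coeFn_smul c u.1)
  norm_triangle u v := by
    rw [LH.norm_def, LH.norm_def, LH.norm_def]
    exact (luxNorm_congr (AEEqFun.coeFn_add u.1 v.1)).trans_le
      (h.luxNorm_add_le u.1.aestronglyMeasurable u.2 v.2)
  norm_eq_zero_iff u := by
    constructor
    · intro h0
      refine Subtype.ext (AEEqFun.ext ?_)
      exact (h.ae_eq_zero_of_luxNorm_eq_zero u.1.aestronglyMeasurable u.2 h0).trans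
        AEEqFun.coeFn_zero.symm
    · rintro rfl
      rw [LH.norm_def, ← h.luxNorm_zero (F := F)]
      exact luxNorm_congr AEEqFun.coeFn_zero

noncomputable instance : NormedAddCommGroup (LH h F) := NormedAddCommGroup.ofCore LH.core

noncomputable instance : NormedSpace ℝ (LH h F) := NormedSpace.ofCore LH.core

theorem LH.integrableOn (u : LH h F) :
    IntegrableOn (u : EuclideanSpace ℝ (Fin N) →ₘ[volume.restrict Ω] F) Ω :=
  h.integrable_of_hasFiniteModular u.1.aestronglyMeasurable u.2

end Space

/-! ## The Sobolev spaces `W^{1,H}(Ω)` and `W₀^{1,H}(Ω)` -/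

section Sobolev

variable {N : ℕ}

/-- Test functions: `φ ∈ C₀^∞(Ω)`. -/
structure IsTestFunction (Ω : Set (EuclideanSpace ℝ (Fin N)))
    (φ : EuclideanSpace ℝ (Fin N) → ℝ) : Prop where
  contDiff : ContDiff ℝ ∞ φ
  hasCompactSupport : HasCompactSupport φ
  tsupport_subset : tsupport φ ⊆ Ω

/-- `g` is the weak (distributional) gradient of `u` in `Ω`. -/
def IsWeakGradient (Ω : Set (EuclideanSpace ℝ (Fin N))) (u : EuclideanSpace ℝ (Fin N) → ℝ)
    (g : EuclideanSpace ℝ (Fin N) → EuclideanSpace ℝ (Fin N)) : Prop :=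
  ∀ φ, IsTestFunction Ω φ → ∫ x in Ω, u x • gradient φ x = - ∫ x in Ω, φ x • g x

theorem IsTestFunction.continuous_gradient {Ω : Set (EuclideanSpace ℝ (Fin N))}
    {φ : EuclideanSpace ℝ (Fin N) → ℝ} (hφ : IsTestFunction Ω φ) : Continuous (gradient φ) :=
  (InnerProductSpace.toDual ℝ (EuclideanSpace ℝ (Fin N))).symm.continuous.comp
    (hφ.contDiff.continuous_fderiv (by simp))

theorem IsTestFunction.hasCompactSupport_gradient {Ω : Set (EuclideanSpace ℝ (Fin N))}
    {φ : EuclideanSpace ℝ (Fin N) → ℝ} (hφ : IsTestFunction Ω φ) :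
    HasCompactSupport (gradient φ) :=
  (hφ.hasCompactSupport.fderiv (𝕜 := ℝ)).comp_left (map_zero _)

variable {Ω : Set (EuclideanSpace ℝ (Fin N))} {p q μ : EuclideanSpace ℝ (Fin N) → ℝ}

theorem LH.integrable_smul_gradient {h : Condition Ω p q μ} (u : LH h ℝ)
    {φ : EuclideanSpace ℝ (Fin N) → ℝ} (hφ : IsTestFunction Ω φ) :
    Integrable (fun x => u.1 x • gradient φ x) (volume.restrict Ω) := by
  obtain ⟨C, hC⟩ := hφ.hasCompactSupport_gradient.exists_bound_of_continuous hφ.continuous_gradient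
  exact Integrable.smul_bdd (LH.integrableOn u) C hφ.continuous_gradient.aestronglyMeasurable
    (Eventually.of_forall hC)

theorem LH.integrable_smul_test {h : Condition Ω p q μ} (g : LH h (EuclideanSpace ℝ (Fin N)))
    {φ : EuclideanSpace ℝ (Fin N) → ℝ} (hφ : IsTestFunction Ω φ) :
    Integrable (fun x => φ x • g.1 x) (volume.restrict Ω) := by
  obtain ⟨C, hC⟩ := hφ.hasCompactSupport.exists_bound_of_continuous hφ.contDiff.continuous
  exact Integrable.bdd_smul (LH.integrableOn g) C hφ.contDiff.continuous.aestronglyMeasurable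
    (Eventually.of_forall hC)

/-- The Sobolev space `W^{1,H}(Ω)` of the functions `u ∈ L^H(Ω)` that have a weak gradient `∇u`
with `|∇u| ∈ L^H(Ω)`. An element is recorded as the pair `(u, ∇u)`, in which the second entry is
determined by the first (`weakGradient_unique`); the norm, inherited from the `ℓ¹`-product, is
`‖u‖_H + ‖∇u‖_H`. -/
def W1H (h : Condition Ω p q μ) :
    Submodule ℝ (WithLp 1 (LH h ℝ × LH h (EuclideanSpace ℝ (Fin N)))) where
  carrier := {w | IsWeakGradient Ω w.fst.1 w.snd.1}
  zero_mem' := fun φ _ => by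
    have h1 : ∫ x in Ω, (0 : EuclideanSpace ℝ (Fin N) →ₘ[volume.restrict Ω] ℝ) x • gradient φ x
        = 0 := by
      rw [integral_congr_ae (g := fun _ => 0), integral_zero]
      filter_upwards [AEEqFun.coeFn_zero (α := EuclideanSpace ℝ (Fin N))
        (μ := volume.restrict Ω) (β := ℝ)] with x hx
      simp [hx]
    have h2 : ∫ x in Ω, φ x • (0 : EuclideanSpace ℝ (Fin N) →ₘ[volume.restrict Ω]
        EuclideanSpace ℝ (Fin N)) x = 0 := by
      rw [integral_congr_ae (g := fun _ => 0), integral_zero]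
      filter_upwards [AEEqFun.coeFn_zero (α := EuclideanSpace ℝ (Fin N))
        (μ := volume.restrict Ω) (β := EuclideanSpace ℝ (Fin N))] with x hx
      simp [hx]
    exact h1.trans (by rw [← neg_zero, ← h2]; rfl)
  add_mem' := fun {w z} hw hz φ hφ => by
    have h1 : ∫ x in Ω, (w + z).fst.1 x • gradient φ x =
        (∫ x in Ω, w.fst.1 x • gradient φ x) + ∫ x in Ω, z.fst.1 x • gradient φ x := by
      rw [← integral_add (LH.integrable_smul_gradient w.fst hφ) (LH.integrable_smul_gradient z.fst hφ)]
      refine integral_congr_ae ?_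
      filter_upwards [AEEqFun.coeFn_add w.fst.1 z.fst.1] with x hx
      rw [← add_smul]
      exact congrArg (· • gradient φ x) hx
    have h2 : ∫ x in Ω, φ x • (w + z).snd.1 x =
        (∫ x in Ω, φ x • w.snd.1 x) + ∫ x in Ω, φ x • z.snd.1 x := by
      rw [← integral_add (LH.integrable_smul_test w.snd hφ) (LH.integrable_smul_test z.snd hφ)]
      refine integral_congr_ae ?_
      filter_upwards [AEEqFun.coeFn_add w.snd.1 z.snd.1] with x hx
      rw [← smul_add]
      exact congrArg (φ x • ·) hx
    rw [h1, h2, hw φ hφ, hz φ hφ, neg_add]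
  smul_mem' := fun c w hw φ hφ => by
    have h1 : ∫ x in Ω, (c • w).fst.1 x • gradient φ x =
        c • ∫ x in Ω, w.fst.1 x • gradient φ x := by
      rw [← integral_smul]
      refine integral_congr_ae ?_
      filter_upwards [AEEqFun.coeFn_smul c w.fst.1] with x hx
      rw [← smul_assoc]
      exact congrArg (· • gradient φ x) hx
    have h2 : ∫ x in Ω, φ x • (c • w).snd.1 x = c • ∫ x in Ω, φ x • w.snd.1 x := by
      rw [← integral_smul]
      refine integral_congr_ae ?_
      filter_upwards [AEEqFun.coeFn_smul c w.snd.1] with x hx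
      rw [smul_comm]
      exact congrArg (φ x • ·) hx
    rw [h1, h2, hw φ hφ, smul_neg]

/-- A function in `L^H(Ω)` has at most one weak gradient in `L^H(Ω)`. -/
theorem weakGradient_unique {h : Condition Ω p q μ} {w z : WithLp 1 (LH h ℝ ×
    LH h (EuclideanSpace ℝ (Fin N)))} (hw : w ∈ W1H h) (hz : z ∈ W1H h)
    (hwz : w.fst = z.fst) : w.snd = z.snd := by
  refine Subtype.ext (AEEqFun.ext ?_)
  have hloc : LocallyIntegrableOn (fun x => w.snd.1 x - z.snd.1 x) Ω :=
    IntegrableOn.locallyIntegrableOn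
      (Integrable.sub (μ := volume.restrict Ω) (LH.integrableOn w.snd) (LH.integrableOn z.snd))
  have := h.isOpen.ae_eq_zero_of_integral_contDiff_smul_eq_zero hloc fun φ h1 h2 h3 => by
    have hφ : IsTestFunction Ω φ := ⟨h1, h2, h3⟩
    have e1 := hw φ hφ
    rw [hwz, hz φ hφ, neg_inj] at e1
    rw [← setIntegral_eq_integral_of_forall_compl_eq_zero (s := Ω)]
    · simp only [smul_sub]
      rw [integral_sub (LH.integrable_smul_test w.snd hφ) (LH.integrable_smul_test z.snd hφ), e1,
        sub_self]
    · intro x hx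
      rw [image_eq_zero_of_notMem_tsupport fun hx' => hx (h3 hx'), zero_smul]
  rw [EventuallyEq, ae_restrict_iff' h.isOpen.measurableSet]
  filter_upwards [this] with x hx hxΩ using sub_eq_zero.1 (hx hxΩ)

theorem IsTestFunction.add {φ ψ : EuclideanSpace ℝ (Fin N) → ℝ} (hφ : IsTestFunction Ω φ)
    (hψ : IsTestFunction Ω ψ) : IsTestFunction Ω (φ + ψ) where
  contDiff := hφ.contDiff.add hψ.contDiff
  hasCompactSupport := hφ.hasCompactSupport.add hψ.hasCompactSupport
  tsupport_subset := (closure_mono (Function.support_add φ ψ)).trans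
    (by rw [closure_union]; exact union_subset hφ.tsupport_subset hψ.tsupport_subset)

theorem IsTestFunction.smul {φ : EuclideanSpace ℝ (Fin N) → ℝ} (hφ : IsTestFunction Ω φ)
    (c : ℝ) : IsTestFunction Ω (c • φ) where
  contDiff := hφ.contDiff.const_smul c
  hasCompactSupport := HasCompactSupport.smul_left (f := fun _ => c) hφ.hasCompactSupport
  tsupport_subset := (tsupport_smul_subset_right (fun _ => c) φ).trans hφ.tsupport_subset

theorem IsTestFunction.zero : IsTestFunction Ω (0 : EuclideanSpace ℝ (Fin N) → ℝ) where
  contDiff := contDiff_const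
  hasCompactSupport := HasCompactSupport.zero
  tsupport_subset := by simp [tsupport]

/-- `C₀^∞(Ω)` as a subspace of `W^{1,H}(Ω)` (the gradient component of an element is
automatically the gradient of `φ`, and every `φ` occurs: see `exists_mem_testSubmodule`). -/
def testSubmodule (h : Condition Ω p q μ) : Submodule ℝ (W1H h) where
  carrier := {w | ∃ φ, IsTestFunction Ω φ ∧ w.1.fst.1 =ᵐ[volume.restrict Ω] φ}
  zero_mem' := ⟨0, IsTestFunction.zero, AEEqFun.coeFn_zero⟩
  add_mem' := by
    rintro w z ⟨φ, hφ, hw⟩ ⟨ψ, hψ, hz⟩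
    exact ⟨φ + ψ, hφ.add hψ, (AEEqFun.coeFn_add w.1.fst.1 z.1.fst.1).trans (hw.add hz)⟩
  smul_mem' := by
    rintro c w ⟨φ, hφ, hw⟩
    exact ⟨c • φ, hφ.smul c, (AEEqFun.coeFn_smul c w.1.fst.1).trans (hw.const_smul c)⟩

/-- Bounded functions have finite modular. -/
theorem Condition.hasFiniteModular_of_bounded (h : Condition Ω p q μ) {F : Type*}
    [NormedAddCommGroup F] [NormedSpace ℝ F] {u : EuclideanSpace ℝ (Fin N) → F} {C : ℝ}
    (hC : ∀ x, ‖u x‖ ≤ C) : HasFiniteModular Ω p q μ u := by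
  have hC0 : 0 ≤ C := (norm_nonneg _).trans (hC 0)
  refine ⟨(C + 1)⁻¹, by positivity, ?_⟩
  have hI : Integrable (fun x => 1 + μ x) (volume.restrict Ω) :=
    Integrable.add (integrableOn_const (h.isBounded.measure_lt_top).ne) h.integrableOn_μ
  refine lt_of_le_of_lt (lintegral_mono_ae ?_) hI.lintegral_lt_top
  filter_upwards [h.ae_bounds] with x hx
  refine ENNReal.ofReal_le_ofReal ?_
  have h1 : ‖(C + 1)⁻¹ • u x‖ ≤ 1 := by
    rw [norm_smul, Real.norm_of_nonneg (by positivity), inv_mul_le_iff₀ (by positivity)]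
    linarith [hC x]
  unfold phaseFun
  have h2 := Real.rpow_le_one (z := p x) (norm_nonneg _) h1 (by linarith)
  have h3 := mul_le_of_le_one_right hx.2.2
    (Real.rpow_le_one (z := q x) (norm_nonneg _) h1 (by linarith))
  linarith

/-- The gradient of a test function is its weak gradient. -/
theorem IsTestFunction.isWeakGradient {φ : EuclideanSpace ℝ (Fin N) → ℝ}
    (hφ : IsTestFunction Ω φ) : IsWeakGradient Ω φ (gradient φ) := by
  intro ψ hψ
  rw [setIntegral_eq_integral_of_forall_compl_eq_zero (fun x hx => by
      rw [image_eq_zero_of_notMem_tsupport fun hx' => hx (hφ.tsupport_subset hx'), zero_smul]),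
    setIntegral_eq_integral_of_forall_compl_eq_zero (fun x hx => by
      rw [image_eq_zero_of_notMem_tsupport fun hx' => hx (hψ.tsupport_subset hx'), zero_smul])]
  have i1 : Integrable (fun x => φ x • gradient ψ x) :=
    (hφ.contDiff.continuous.smul hψ.continuous_gradient).integrable_of_hasCompactSupport
      hφ.hasCompactSupport.smul_right
  have i2 : Integrable (fun x => ψ x • gradient φ x) :=
    (hψ.contDiff.continuous.smul hφ.continuous_gradient).integrable_of_hasCompactSupport
      hψ.hasCompactSupport.smul_right
  have i3 : Integrable (fun x => φ x * ψ x) :=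
    (hφ.contDiff.continuous.mul hψ.contDiff.continuous).integrable_of_hasCompactSupport
      hφ.hasCompactSupport.mul_right
  have e : ∀ (f : EuclideanSpace ℝ (Fin N) → ℝ) (x v : EuclideanSpace ℝ (Fin N)),
      inner ℝ v (gradient f x) = fderiv ℝ f x v := fun f x v => by
    rw [real_inner_comm]; exact InnerProductSpace.toDual_symm_apply
  refine ext_inner_left ℝ fun v => ?_
  rw [inner_neg_right, ← integral_inner i1, ← integral_inner i2]
  have j1 := i1.const_inner (𝕜 := ℝ) v
  have j2 := i2.const_inner (𝕜 := ℝ) v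
  simp only [inner_smul_right, e] at j1 j2 ⊢
  rw [integral_mul_fderiv_eq_neg_fderiv_mul_of_integrable (by simpa only [mul_comm] using j2) j1 i3
    (fun x _ => hφ.contDiff.differentiable (by simp) x)
    (fun x _ => hψ.contDiff.differentiable (by simp) x)]
  simp only [mul_comm]

/-- Every test function `φ`, with its classical gradient, is an element of `testSubmodule`. -/
theorem exists_mem_testSubmodule (h : Condition Ω p q μ) {φ : EuclideanSpace ℝ (Fin N) → ℝ}
    (hφ : IsTestFunction Ω φ) : ∃ w ∈ testSubmodule h,
      w.1.fst.1 =ᵐ[volume.restrict Ω] φ ∧ w.1.snd.1 =ᵐ[volume.restrict Ω] gradient φ := by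
  obtain ⟨C, hC⟩ := hφ.hasCompactSupport.exists_bound_of_continuous hφ.contDiff.continuous
  obtain ⟨D, hD⟩ := hφ.hasCompactSupport_gradient.exists_bound_of_continuous hφ.continuous_gradient
  have m1 : AEStronglyMeasurable φ (volume.restrict Ω) :=
    hφ.contDiff.continuous.aestronglyMeasurable
  have m2 : AEStronglyMeasurable (gradient φ) (volume.restrict Ω) :=
    hφ.continuous_gradient.aestronglyMeasurable
  have e1 := AEEqFun.coeFn_mk φ m1
  have e2 := AEEqFun.coeFn_mk (gradient φ) m2
  let u : LH h ℝ := ⟨AEEqFun.mk φ m1, (h.hasFiniteModular_of_bounded hC).congr e1.symm⟩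
  let g : LH h (EuclideanSpace ℝ (Fin N)) :=
    ⟨AEEqFun.mk (gradient φ) m2, (h.hasFiniteModular_of_bounded hD).congr e2.symm⟩
  have hw : WithLp.toLp 1 (u, g) ∈ W1H h := by
    intro ψ hψ
    have h1 : ∫ x in Ω, u.1 x • gradient ψ x = ∫ x in Ω, φ x • gradient ψ x :=
      integral_congr_ae (by filter_upwards [e1] with x hx; exact congrArg (· • gradient ψ x) hx)
    have h2 : ∫ x in Ω, ψ x • g.1 x = ∫ x in Ω, ψ x • gradient φ x :=
      integral_congr_ae (by filter_upwards [e2] with x hx; exact congrArg (ψ x • ·) hx)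
    exact h1.trans ((hφ.isWeakGradient ψ hψ).trans (congrArg Neg.neg h2.symm))
  exact ⟨⟨_, hw⟩, ⟨φ, hφ, e1⟩, e1, e2⟩

/-- `W₀^{1,H}(Ω)`, the closure of `C₀^∞(Ω)` in `W^{1,H}(Ω)`, with the norm of `W^{1,H}(Ω)`. -/
noncomputable def W01H (h : Condition Ω p q μ) : Submodule ℝ (W1H h) :=
  (testSubmodule h).topologicalClosure

/-- The weak gradient `∇u` of `u ∈ W₀^{1,H}(Ω)`. -/
noncomputable def grad {h : Condition Ω p q μ} (u : W01H h) :
    EuclideanSpace ℝ (Fin N) → EuclideanSpace ℝ (Fin N) :=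
  u.1.1.snd.1

/-! ## The energy and the double phase operator -/

/-- The integrand of the energy: `|∇u|^{p(x)} / p(x) + μ(x) |∇u|^{q(x)} / q(x)`. -/
noncomputable def energyIntegrand {h : Condition Ω p q μ} (u : W01H h)
    (x : EuclideanSpace ℝ (Fin N)) : ℝ :=
  ‖grad u x‖ ^ p x / p x + μ x * (‖grad u x‖ ^ q x / q x)

/-- The energy functional `I`. -/
noncomputable def energy (h : Condition Ω p q μ) (u : W01H h) : ℝ :=
  ∫ x in Ω, energyIntegrand u x

/-- The integrand of `⟨A(u), v⟩`:
`|∇u|^{p(x)-2} ∇u · ∇v + μ(x) |∇u|^{q(x)-2} ∇u · ∇v`. -/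
noncomputable def operatorIntegrand {h : Condition Ω p q μ} (u v : W01H h)
    (x : EuclideanSpace ℝ (Fin N)) : ℝ :=
  ‖grad u x‖ ^ (p x - 2) * inner ℝ (grad u x) (grad v x) +
    μ x * (‖grad u x‖ ^ (q x - 2) * inner ℝ (grad u x) (grad v x))

/-- `A : W₀^{1,H}(Ω) → W₀^{1,H}(Ω)*` is the double phase operator: each pairing `⟨A(u), v⟩` is
the integral of the (integrable) function `operatorIntegrand u v`. This determines `A`. -/
def IsDoublePhaseOperator (h : Condition Ω p q μ) (A : W01H h → StrongDual ℝ (W01H h)) : Prop :=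
  ∀ u v, IntegrableOn (operatorIntegrand u v) Ω ∧ A u v = ∫ x in Ω, operatorIntegrand u v x

end Sobolev

end DoublePhase

/-!
The energy is a convex functional of the gradient, and pointwise the flux
`J_x ξ = |ξ|^{p(x)-2} ξ + μ(x) |ξ|^{q(x)-2} ξ` is a subgradient of its density at `ξ`, so that
`⟨A(u), w - u⟩ ≤ I(w) - I(u)` for all `u` and `w`. A selection of subgradients that is continuous
in norm is the Fréchet derivative, so it remains to show that `A` is continuous.

The exponents take values in a compact interval `[a, b] ⊆ (1, ∞)`. There homogeneity (which reduces
to `|ξ| = 1`) and Young's inequality give, for every `ε > 0` and uniformly in the exponent `e`,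
`|⟨|θ|^{e-2} θ - |ξ|^{e-2} ξ, ζ⟩| ≤ ε (|ξ|^e + |ζ|^e) + C |θ - ξ|^e`.
Adding the two phases and integrating over `Ω` bounds `⟨A(w) - A(u), v⟩` by
`ε (ρ(∇u) + ρ(∇v)) + C ρ(∇w - ∇u)`. Since the modular `ρ` is at most the Luxemburg norm on the unit
ball, this is the continuity of `A`. Only the values of the gradients enter, so the argument takes
place on `L^H(Ω; F)` and is pulled back along any continuous linear map into it.
-/

namespace DoublePhase

section RpowInequalities

variable {e : ℝ}

theorem rpow_sub_one_mul_le {s t : ℝ} (he : 1 ≤ e) (hs : 0 ≤ s) (ht : 0 ≤ t) :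
    s ^ (e - 1) * t ≤ (1 - e⁻¹) * s ^ e + e⁻¹ * t ^ e := by
  have he0 : e ≠ 0 := by positivity
  have amgm := Real.geom_mean_le_arith_mean2_weighted (sub_nonneg.2 (inv_le_one_of_one_le₀ he))
    (by positivity) (Real.rpow_nonneg hs e) (Real.rpow_nonneg ht e) (sub_add_cancel 1 e⁻¹)
  rwa [← Real.rpow_mul hs, ← Real.rpow_mul ht, mul_sub, mul_one, mul_inv_cancel₀ he0,
    Real.rpow_one] at amgm

theorem rpow_sub_one_mul_le_add {s t : ℝ} (he : 1 ≤ e) (hs : 0 ≤ s) (ht : 0 ≤ t) :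
    s ^ (e - 1) * t ≤ s ^ e + t ^ e :=
  (rpow_sub_one_mul_le he hs ht).trans <| add_le_add
    (mul_le_of_le_one_left (Real.rpow_nonneg hs e) (sub_le_self 1 (by positivity)))
    (mul_le_of_le_one_left (Real.rpow_nonneg ht e) (inv_le_one_of_one_le₀ he))

theorem exists_rpow_sub_one_mul_le {a ε : ℝ} (ha : 1 < a) (hε : 0 < ε) :
    ∃ C : ℝ, 0 ≤ C ∧ ∀ e, a ≤ e → ∀ s t : ℝ, 0 ≤ s → 0 ≤ t →
      s ^ (e - 1) * t ≤ C * s ^ e + ε * t ^ e := by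
  obtain ⟨L, hLε, hL⟩ := (((tendsto_rpow_neg_atTop (sub_pos.2 ha)).eventually_le_const hε).and
    (eventually_ge_atTop 1)).exists
  have hL0 : 0 < L := one_pos.trans_le hL
  refine ⟨L, hL0.le, fun e he s t hs ht => ?_⟩
  have hLe : L ^ (-(e - 1)) ≤ ε :=
    (Real.rpow_le_rpow_of_exponent_le hL (by linarith)).trans hLε
  -- Young's inequality for `L s` and `t`, divided by `L ^ (e - 1)`
  calc s ^ (e - 1) * t = L ^ (-(e - 1)) * ((L * s) ^ (e - 1) * t) := by
        rw [Real.mul_rpow hL0.le hs, Real.rpow_neg hL0.le]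
        field_simp
    _ ≤ L ^ (-(e - 1)) * ((L * s) ^ e + t ^ e) := by
        gcongr
        exact rpow_sub_one_mul_le_add (by linarith) (by positivity) ht
    _ = L * s ^ e + L ^ (-(e - 1)) * t ^ e := by
        rw [Real.mul_rpow hL0.le hs, mul_add, ← mul_assoc, ← Real.rpow_add hL0, neg_sub,
          sub_add_cancel, Real.rpow_one]
    _ ≤ L * s ^ e + ε * t ^ e := by gcongr

theorem abs_rpow_sub_one_le_abs_rpow_sub_one {s k b : ℝ} (hs : 0 < s) (hk : 0 ≤ k) (hkb : k ≤ b) :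
    |s ^ k - 1| ≤ |s ^ b - 1| := by
  rcases le_total 1 s with h1 | h1
  · have hmono := Real.rpow_le_rpow_of_exponent_le h1 hkb
    have hone := Real.one_le_rpow h1 hk
    rw [abs_of_nonneg (by linarith), abs_of_nonneg (by linarith)]
    linarith
  · have hanti := Real.rpow_le_rpow_of_exponent_ge hs h1 hkb
    have hone := Real.rpow_le_one hs.le h1 hk
    rw [abs_of_nonpos (by linarith), abs_of_nonpos (by linarith)]
    linarith

theorem exists_abs_rpow_sub_one_le (b : ℝ) {ε : ℝ} (hε : 0 < ε) :
    ∃ δ : ℝ, 0 < δ ∧ ∀ k ∈ Icc 0 b, ∀ s : ℝ, |s - 1| ≤ δ → |s ^ k - 1| ≤ ε := by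
  have hcont : ContinuousAt (fun s : ℝ => s ^ b) 1 :=
    Real.continuousAt_rpow_const _ _ (Or.inl one_ne_zero)
  obtain ⟨d, hd, hdε⟩ := Metric.continuousAt_iff.1 hcont ε hε
  refine ⟨min d 1 / 2, by positivity, fun k hk s hs => ?_⟩
  have hs_lt : |s - 1| < min d 1 := hs.trans_lt (half_lt_self (by positivity))
  have hs0 : 0 < s := by linarith [(abs_lt.1 (hs_lt.trans_le (min_le_right d 1))).1]
  have hsb : |s ^ b - 1| < ε := by
    simpa [Real.dist_eq] using hdε (hs_lt.trans_le (min_le_left d 1))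
  exact (abs_rpow_sub_one_le_abs_rpow_sub_one hs0 hk.1 hk.2).trans hsb.le

end RpowInequalities

section RpowFlux

variable {F : Type*} [NormedAddCommGroup F] [NormedSpace ℝ F] {e : ℝ}

/-- The vector `|ξ|^{e-2} ξ`, which for `1 < e` in an inner product space is the gradient of
`ξ ↦ |ξ|^e / e`; the scalar multiple by `ξ` makes the value at `ξ = 0` equal to `0` for
every `e`. -/
noncomputable def rpowFlux (e : ℝ) (ξ : F) : F :=
  ‖ξ‖ ^ (e - 2) • ξ

theorem norm_rpowFlux (he : e ≠ 1) (ξ : F) : ‖rpowFlux e ξ‖ = ‖ξ‖ ^ (e - 1) := by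
  rcases eq_or_ne ξ 0 with rfl | hξ
  · simp [rpowFlux, Real.zero_rpow (sub_ne_zero.2 he)]
  · rw [rpowFlux, norm_smul, Real.norm_of_nonneg (by positivity),
      ← Real.rpow_add_one (norm_ne_zero_iff.2 hξ)]
    ring_nf

theorem rpowFlux_smul {c : ℝ} (hc : 0 < c) (ξ : F) :
    rpowFlux e (c • ξ) = c ^ (e - 1) • rpowFlux e ξ := by
  have hc_pow : c ^ (e - 1) = c ^ (e - 2) * c := by
    rw [← Real.rpow_add_one hc.ne']
    ring_nf
  rw [rpowFlux, rpowFlux, norm_smul, Real.norm_of_nonneg hc.le,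
    Real.mul_rpow hc.le (norm_nonneg ξ), hc_pow]
  module

theorem norm_rpowFlux_sub_self (he : e ≠ 1) (θ : F) :
    ‖rpowFlux e θ - θ‖ = |‖θ‖ ^ (e - 1) - ‖θ‖| := by
  rcases eq_or_ne θ 0 with rfl | hθ
  · simp [rpowFlux, Real.zero_rpow (sub_ne_zero.2 he)]
  have hθ_pow : ‖θ‖ ^ (e - 1) - ‖θ‖ = (‖θ‖ ^ (e - 2) - 1) * ‖θ‖ := by
    rw [sub_one_mul, ← Real.rpow_add_one (norm_ne_zero_iff.2 hθ)]
    ring_nf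
  have hvec : rpowFlux e θ - θ = (‖θ‖ ^ (e - 2) - 1) • θ := by rw [rpowFlux, sub_smul, one_smul]
  rw [hvec, norm_smul, Real.norm_eq_abs, hθ_pow, abs_mul, abs_norm]

theorem norm_rpowFlux_sub_le_of_le_norm_sub {b δ : ℝ} (he : 1 < e) (heb : e ≤ b) (hδ : 0 < δ)
    {ξ θ : F} (hξ : ‖ξ‖ = 1) (h : δ ≤ ‖θ - ξ‖) :
    ‖rpowFlux e θ - ξ‖ ≤ 2 * (1 + δ⁻¹) ^ b * ‖θ - ξ‖ ^ (e - 1) := by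
  have hone_le : 1 ≤ δ⁻¹ * ‖θ - ξ‖ := by rwa [← div_eq_inv_mul, one_le_div₀ hδ]
  have hbound : 1 + ‖θ - ξ‖ ≤ (1 + δ⁻¹) * ‖θ - ξ‖ := by linarith
  have hθ : ‖θ‖ ≤ 1 + ‖θ - ξ‖ := hξ ▸ norm_le_norm_add_norm_sub' θ ξ
  calc ‖rpowFlux e θ - ξ‖ ≤ ‖θ‖ ^ (e - 1) + 1 := by
        simpa only [norm_rpowFlux he.ne', hξ] using norm_sub_le (rpowFlux e θ) ξ
    _ ≤ (1 + ‖θ - ξ‖) ^ (e - 1) + (1 + ‖θ - ξ‖) ^ (e - 1) := by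
        gcongr
        exact Real.one_le_rpow (by simp) (by linarith)
    _ ≤ 2 * ((1 + δ⁻¹) * ‖θ - ξ‖) ^ (e - 1) := by
        rw [← two_mul]
        gcongr
    _ = 2 * (1 + δ⁻¹) ^ (e - 1) * ‖θ - ξ‖ ^ (e - 1) := by
        rw [Real.mul_rpow (by positivity) (norm_nonneg _), mul_assoc]
    _ ≤ 2 * (1 + δ⁻¹) ^ b * ‖θ - ξ‖ ^ (e - 1) := by
        gcongr
        · exact le_add_of_nonneg_right (by positivity)
        · linarith

variable (F)

theorem exists_norm_rpowFlux_sub_unit_le (b : ℝ) {ε : ℝ} (hε : 0 < ε) :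
    ∃ C : ℝ, 0 ≤ C ∧ ∀ e, 1 < e → e ≤ b → ∀ ξ θ : F, ‖ξ‖ = 1 →
      ‖rpowFlux e θ - ξ‖ ≤ ε + C * ‖θ - ξ‖ ^ (e - 1) := by
  obtain ⟨d, hd, hrpow⟩ := exists_abs_rpow_sub_one_le b (half_pos hε)
  set δ := min d (ε / 4)
  have hδ : 0 < δ := by positivity
  refine ⟨2 * (1 + δ⁻¹) ^ b, by positivity, fun e he heb ξ θ hξ => ?_⟩
  rcases le_total δ ‖θ - ξ‖ with far | near
  · exact (norm_rpowFlux_sub_le_of_le_norm_sub he heb hδ hξ far).trans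
      (le_add_of_nonneg_left hε.le)
  · have hθ : |‖θ‖ - 1| ≤ ‖θ - ξ‖ := hξ ▸ abs_norm_sub_norm_le θ ξ
    have hpow : |‖θ‖ ^ (e - 1) - 1| ≤ ε / 2 :=
      hrpow _ ⟨by linarith, by linarith⟩ _ (hθ.trans (near.trans (min_le_left _ _)))
    have hδε : ‖θ - ξ‖ ≤ ε / 4 := near.trans (min_le_right _ _)
    calc ‖rpowFlux e θ - ξ‖ ≤ ‖rpowFlux e θ - θ‖ + ‖θ - ξ‖ := norm_sub_le_norm_sub_add_norm_sub ..
      _ ≤ |‖θ‖ ^ (e - 1) - 1| + |‖θ‖ - 1| + ‖θ - ξ‖ := by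
          rw [norm_rpowFlux_sub_self he.ne', ← sub_sub_sub_cancel_right _ _ 1]
          gcongr
          exact abs_sub _ _
      _ ≤ ε := by linarith
      _ ≤ ε + 2 * (1 + δ⁻¹) ^ b * ‖θ - ξ‖ ^ (e - 1) := le_add_of_nonneg_right (by positivity)

theorem exists_norm_rpowFlux_sub_le (b : ℝ) {ε : ℝ} (hε : 0 < ε) :
    ∃ C : ℝ, 0 < C ∧ ∀ e, 1 < e → e ≤ b → ∀ ξ θ : F,
      ‖rpowFlux e θ - rpowFlux e ξ‖ ≤ ε * ‖ξ‖ ^ (e - 1) + C * ‖θ - ξ‖ ^ (e - 1) := by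
  obtain ⟨C, hC, hunit⟩ := exists_norm_rpowFlux_sub_unit_le F b hε
  refine ⟨C + 1, by positivity, fun e he heb ξ θ => ?_⟩
  rcases eq_or_ne ξ 0 with rfl | hξ
  · have hzero : rpowFlux e (0 : F) = 0 := smul_zero _
    rw [hzero, sub_zero, sub_zero, norm_rpowFlux he.ne', add_one_mul, ← add_assoc]
    exact le_add_of_nonneg_left (by positivity)
  -- by homogeneity `ξ` may be replaced by a unit vector
  obtain ⟨r, ξ₁, hr, hξ₁, rfl⟩ : ∃ (r : ℝ) (ξ₁ : F), 0 < r ∧ ‖ξ₁‖ = 1 ∧ ξ = r • ξ₁ :=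
    ⟨‖ξ‖, ‖ξ‖⁻¹ • ξ, norm_pos_iff.2 hξ, norm_smul_inv_norm hξ,
      (smul_inv_smul₀ (norm_ne_zero_iff.2 hξ) ξ).symm⟩
  obtain ⟨θ₁, rfl⟩ : ∃ θ₁, θ = r • θ₁ := ⟨r⁻¹ • θ, (smul_inv_smul₀ hr.ne' θ).symm⟩
  have hfix : rpowFlux e ξ₁ = ξ₁ := by rw [rpowFlux, hξ₁, Real.one_rpow, one_smul]
  rw [rpowFlux_smul hr, rpowFlux_smul hr, ← smul_sub, ← smul_sub, hfix, norm_smul, norm_smul,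
    norm_smul, hξ₁, mul_one, Real.norm_of_nonneg hr.le, Real.norm_of_nonneg (by positivity),
    Real.mul_rpow hr.le (norm_nonneg _)]
  calc r ^ (e - 1) * ‖rpowFlux e θ₁ - ξ₁‖
      ≤ r ^ (e - 1) * (ε + (C + 1) * ‖θ₁ - ξ₁‖ ^ (e - 1)) := by
        gcongr
        refine (hunit e he heb ξ₁ θ₁ hξ₁).trans ?_
        gcongr
        exact le_add_of_nonneg_right zero_le_one
    _ = ε * r ^ (e - 1) + (C + 1) * (r ^ (e - 1) * ‖θ₁ - ξ₁‖ ^ (e - 1)) := by ring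

end RpowFlux

section InnerRpowFlux

variable {F : Type*} [NormedAddCommGroup F] [InnerProductSpace ℝ F] {e : ℝ}

theorem inner_rpowFlux_self (he : e ≠ 0) (ξ : F) : inner ℝ (rpowFlux e ξ) ξ = ‖ξ‖ ^ e := by
  rcases eq_or_ne ξ 0 with rfl | hξ
  · simp [Real.zero_rpow he]
  · have hξ' : ‖ξ‖ ≠ 0 := norm_ne_zero_iff.2 hξ
    rw [rpowFlux, real_inner_smul_left, real_inner_self_eq_norm_mul_norm, ← mul_assoc,
      ← Real.rpow_add_one hξ', ← Real.rpow_add_one hξ']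
    ring_nf

theorem abs_inner_rpowFlux_le (he : 1 < e) (ξ ζ : F) :
    |inner ℝ (rpowFlux e ξ) ζ| ≤ ‖ξ‖ ^ e + ‖ζ‖ ^ e :=
  calc |inner ℝ (rpowFlux e ξ) ζ| ≤ ‖ξ‖ ^ (e - 1) * ‖ζ‖ := by
        rw [← norm_rpowFlux he.ne']
        exact abs_real_inner_le_norm _ _
    _ ≤ ‖ξ‖ ^ e + ‖ζ‖ ^ e := rpow_sub_one_mul_le_add he.le (norm_nonneg ξ) (norm_nonneg ζ)

theorem inner_rpowFlux_sub_le (he : 1 < e) (ξ θ : F) :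
    inner ℝ (rpowFlux e ξ) (θ - ξ) ≤ ‖θ‖ ^ e / e - ‖ξ‖ ^ e / e := by
  have cauchy_schwarz : inner ℝ (rpowFlux e ξ) θ ≤ ‖ξ‖ ^ (e - 1) * ‖θ‖ := by
    rw [← norm_rpowFlux he.ne']
    exact real_inner_le_norm _ _
  have young := rpow_sub_one_mul_le he.le (norm_nonneg ξ) (norm_nonneg θ)
  rw [inner_sub_right, inner_rpowFlux_self (by positivity), div_eq_inv_mul, div_eq_inv_mul]
  linarith

variable (F)

theorem exists_abs_inner_rpowFlux_sub_le {a ε : ℝ} (ha : 1 < a) (b : ℝ) (hε : 0 < ε) :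
    ∃ C : ℝ, 0 ≤ C ∧ ∀ e ∈ Icc a b, ∀ ξ θ ζ : F,
      |inner ℝ (rpowFlux e θ - rpowFlux e ξ) ζ| ≤
        ε * (‖ξ‖ ^ e + ‖ζ‖ ^ e) + C * ‖θ - ξ‖ ^ e := by
  obtain ⟨C₁, hC₁, hflux⟩ := exists_norm_rpowFlux_sub_le F b (half_pos hε)
  obtain ⟨C₂, hC₂, hyoung⟩ := exists_rpow_sub_one_mul_le ha (ε := ε / 2 / C₁) (by positivity)
  refine ⟨C₁ * C₂, by positivity, fun e ⟨hae, heb⟩ ξ θ ζ => ?_⟩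
  have he : 1 < e := ha.trans_le hae
  calc |inner ℝ (rpowFlux e θ - rpowFlux e ξ) ζ|
      ≤ ‖rpowFlux e θ - rpowFlux e ξ‖ * ‖ζ‖ := abs_real_inner_le_norm _ _
    _ ≤ (ε / 2 * ‖ξ‖ ^ (e - 1) + C₁ * ‖θ - ξ‖ ^ (e - 1)) * ‖ζ‖ := by
        gcongr
        exact hflux e he heb ξ θ
    _ = ε / 2 * (‖ξ‖ ^ (e - 1) * ‖ζ‖) + C₁ * (‖θ - ξ‖ ^ (e - 1) * ‖ζ‖) := by ring
    _ ≤ ε / 2 * (‖ξ‖ ^ e + ‖ζ‖ ^ e) +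
          C₁ * (C₂ * ‖θ - ξ‖ ^ e + ε / 2 / C₁ * ‖ζ‖ ^ e) := by
        gcongr
        · exact rpow_sub_one_mul_le_add he.le (norm_nonneg ξ) (norm_nonneg ζ)
        · exact hyoung e hae _ _ (norm_nonneg _) (norm_nonneg ζ)
    _ = ε / 2 * (‖ξ‖ ^ e + ‖ζ‖ ^ e) + ε / 2 * ‖ζ‖ ^ e + C₁ * C₂ * ‖θ - ξ‖ ^ e := by
        field_simp
        ring
    _ ≤ ε * (‖ξ‖ ^ e + ‖ζ‖ ^ e) + C₁ * C₂ * ‖θ - ξ‖ ^ e := by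
        have : 0 ≤ ε / 2 * ‖ξ‖ ^ e := by positivity
        linarith

end InnerRpowFlux

section Pointwise

variable {N : ℕ} {p q μ : EuclideanSpace ℝ (Fin N) → ℝ} {x : EuclideanSpace ℝ (Fin N)}
  {F : Type*} [NormedAddCommGroup F] [InnerProductSpace ℝ F]

/-- The convex function `t ↦ t ^ p(x) / p(x) + μ(x) t ^ q(x) / q(x)`, whose composition with
`‖∇u‖` is the integrand of the energy. -/
noncomputable def energyDensity (p q μ : EuclideanSpace ℝ (Fin N) → ℝ)
    (x : EuclideanSpace ℝ (Fin N)) (t : ℝ) : ℝ :=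
  t ^ p x / p x + μ x * (t ^ q x / q x)

/-- The gradient `|ξ|^{p(x)-2} ξ + μ(x) |ξ|^{q(x)-2} ξ` of `ξ ↦ energyDensity p q μ x ‖ξ‖`. -/
noncomputable def flux {F : Type*} [NormedAddCommGroup F] [NormedSpace ℝ F]
    (p q μ : EuclideanSpace ℝ (Fin N) → ℝ) (x : EuclideanSpace ℝ (Fin N)) (ξ : F) : F :=
  rpowFlux (p x) ξ + μ x • rpowFlux (q x) ξ

theorem inner_flux (ξ ζ : F) : inner ℝ (flux p q μ x ξ) ζ =
    inner ℝ (rpowFlux (p x) ξ) ζ + μ x * inner ℝ (rpowFlux (q x) ξ) ζ := by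
  rw [flux, inner_add_left, real_inner_smul_left]

theorem energyDensity_nonneg (hx : 1 < p x ∧ 1 < q x ∧ 0 ≤ μ x) {t : ℝ} (ht : 0 ≤ t) :
    0 ≤ energyDensity p q μ x t := by
  obtain ⟨hp, hq, hμ⟩ := hx
  unfold energyDensity
  positivity

theorem energyDensity_le_phaseFun (hx : 1 < p x ∧ 1 < q x ∧ 0 ≤ μ x) {t : ℝ} (ht : 0 ≤ t) :
    energyDensity p q μ x t ≤ phaseFun p q μ x t := by
  obtain ⟨hp, hq, hμ⟩ := hx
  unfold energyDensity phaseFun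
  gcongr
  · exact div_le_self (Real.rpow_nonneg ht _) hp.le
  · exact div_le_self (Real.rpow_nonneg ht _) hq.le

theorem phaseFun_mul_le {b c t : ℝ} (hp : p x ∈ Icc 0 b) (hq : q x ∈ Icc 0 b) (hμ : 0 ≤ μ x)
    (hc : 0 ≤ c) (ht : 0 ≤ t) :
    phaseFun p q μ x (c * t) ≤ max 1 c ^ b * phaseFun p q μ x t := by
  have rpow_le : ∀ e ∈ Icc 0 b, (c * t) ^ e ≤ max 1 c ^ b * t ^ e := fun e he => by
    rw [Real.mul_rpow hc ht]
    gcongr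
    exact (Real.rpow_le_rpow hc (le_max_right 1 c) he.1).trans
      (Real.rpow_le_rpow_of_exponent_le (le_max_left 1 c) he.2)
  calc phaseFun p q μ x (c * t)
      ≤ max 1 c ^ b * t ^ p x + μ x * (max 1 c ^ b * t ^ q x) := by
        unfold phaseFun
        gcongr
        · exact rpow_le _ hp
        · exact rpow_le _ hq
    _ = max 1 c ^ b * phaseFun p q μ x t := by
        unfold phaseFun
        ring

theorem abs_inner_flux_le (hx : 1 < p x ∧ 1 < q x ∧ 0 ≤ μ x) (ξ ζ : F) :
    |inner ℝ (flux p q μ x ξ) ζ| ≤ phaseFun p q μ x ‖ξ‖ + phaseFun p q μ x ‖ζ‖ := by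
  obtain ⟨hp, hq, hμ⟩ := hx
  calc |inner ℝ (flux p q μ x ξ) ζ|
      ≤ |inner ℝ (rpowFlux (p x) ξ) ζ| + μ x * |inner ℝ (rpowFlux (q x) ξ) ζ| := by
        rw [inner_flux]
        exact (abs_add_le _ _).trans_eq (by rw [abs_mul, abs_of_nonneg hμ])
    _ ≤ ‖ξ‖ ^ p x + ‖ζ‖ ^ p x + μ x * (‖ξ‖ ^ q x + ‖ζ‖ ^ q x) := by
        gcongr
        · exact abs_inner_rpowFlux_le hp ξ ζ
        · exact abs_inner_rpowFlux_le hq ξ ζ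
    _ = phaseFun p q μ x ‖ξ‖ + phaseFun p q μ x ‖ζ‖ := by
        unfold phaseFun
        ring

theorem inner_flux_sub_le (hx : 1 < p x ∧ 1 < q x ∧ 0 ≤ μ x) (ξ θ : F) :
    inner ℝ (flux p q μ x ξ) (θ - ξ) ≤ energyDensity p q μ x ‖θ‖ - energyDensity p q μ x ‖ξ‖ := by
  obtain ⟨hp, hq, hμ⟩ := hx
  have hsum := add_le_add (inner_rpowFlux_sub_le hp ξ θ)
    (mul_le_mul_of_nonneg_left (inner_rpowFlux_sub_le hq ξ θ) hμ)
  rw [inner_flux]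
  unfold energyDensity
  linarith

theorem exists_abs_inner_flux_sub_le (F : Type*) [NormedAddCommGroup F] [InnerProductSpace ℝ F]
    {a ε : ℝ} (ha : 1 < a) (b : ℝ) (hε : 0 < ε) :
    ∃ C : ℝ, 0 ≤ C ∧ ∀ (p q μ : EuclideanSpace ℝ (Fin N) → ℝ) (x : EuclideanSpace ℝ (Fin N)),
      p x ∈ Icc a b → q x ∈ Icc a b → 0 ≤ μ x → ∀ ξ θ ζ : F,
        |inner ℝ (flux p q μ x θ - flux p q μ x ξ) ζ| ≤
          ε * (phaseFun p q μ x ‖ξ‖ + phaseFun p q μ x ‖ζ‖) + C * phaseFun p q μ x ‖θ - ξ‖ := by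
  obtain ⟨C, hC, hrpow⟩ := exists_abs_inner_rpowFlux_sub_le F ha b hε
  refine ⟨C, hC, fun p q μ x hp hq hμ ξ θ ζ => ?_⟩
  have hsub : inner ℝ (flux p q μ x θ - flux p q μ x ξ) ζ =
      inner ℝ (rpowFlux (p x) θ - rpowFlux (p x) ξ) ζ +
        μ x * inner ℝ (rpowFlux (q x) θ - rpowFlux (q x) ξ) ζ := by
    simp only [inner_sub_left, inner_flux]
    ring
  calc |inner ℝ (flux p q μ x θ - flux p q μ x ξ) ζ|
      ≤ |inner ℝ (rpowFlux (p x) θ - rpowFlux (p x) ξ) ζ| +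
          μ x * |inner ℝ (rpowFlux (q x) θ - rpowFlux (q x) ξ) ζ| := by
        rw [hsub]
        exact (abs_add_le _ _).trans_eq (by rw [abs_mul, abs_of_nonneg hμ])
    _ ≤ ε * (‖ξ‖ ^ p x + ‖ζ‖ ^ p x) + C * ‖θ - ξ‖ ^ p x +
          μ x * (ε * (‖ξ‖ ^ q x + ‖ζ‖ ^ q x) + C * ‖θ - ξ‖ ^ q x) := by
        gcongr
        · exact hrpow _ hp ξ θ ζ
        · exact hrpow _ hq ξ θ ζ
    _ = ε * (phaseFun p q μ x ‖ξ‖ + phaseFun p q μ x ‖ζ‖) + C * phaseFun p q μ x ‖θ - ξ‖ := by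
        unfold phaseFun
        ring

end Pointwise

section Measurability

variable {N : ℕ} {Ω : Set (EuclideanSpace ℝ (Fin N))} {p q μ : EuclideanSpace ℝ (Fin N) → ℝ}
  {F : Type*} [NormedAddCommGroup F] {u : EuclideanSpace ℝ (Fin N) → F}

namespace Condition

theorem exists_exponent_bounds (h : Condition Ω p q μ) :
    ∃ a b : ℝ, 1 < a ∧ ∀ᵐ x ∂volume.restrict Ω, p x ∈ Icc a b ∧ q x ∈ Icc a b := by
  have hcompact : IsCompact (closure Ω) := h.isBounded.isCompact_closure
  have hne : (closure Ω).Nonempty := h.isConnected.nonempty.closure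
  obtain ⟨x₀, hx₀, p_min⟩ := hcompact.exists_isMinOn hne h.continuousOn_p
  obtain ⟨x₁, -, q_max⟩ := hcompact.exists_isMaxOn hne h.continuousOn_q
  refine ⟨p x₀, q x₁, h.one_lt_p x₀ hx₀, ?_⟩
  filter_upwards [ae_restrict_mem h.isOpen.measurableSet] with x hxΩ
  have hx := subset_closure hxΩ
  have hpq := (h.p_lt_q x hx).le
  exact ⟨⟨p_min hx, hpq.trans (q_max hx)⟩, ⟨(p_min hx).trans hpq, q_max hx⟩⟩

theorem aemeasurable_p (h : Condition Ω p q μ) : AEMeasurable p (volume.restrict Ω) :=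
  (h.continuousOn_p.mono subset_closure).aemeasurable h.isOpen.measurableSet

theorem aemeasurable_q (h : Condition Ω p q μ) : AEMeasurable q (volume.restrict Ω) :=
  (h.continuousOn_q.mono subset_closure).aemeasurable h.isOpen.measurableSet

theorem aemeasurable_energyDensity (h : Condition Ω p q μ)
    (hu : AEStronglyMeasurable u (volume.restrict Ω)) :
    AEMeasurable (fun x => energyDensity p q μ x ‖u x‖) (volume.restrict Ω) := by
  have hu_norm := hu.norm.aemeasurable
  exact ((hu_norm.pow h.aemeasurable_p).div h.aemeasurable_p).add
    (h.integrableOn_μ.aemeasurable.mul ((hu_norm.pow h.aemeasurable_q).div h.aemeasurable_q))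

theorem aestronglyMeasurable_flux [NormedSpace ℝ F] (h : Condition Ω p q μ)
    (hu : AEStronglyMeasurable u (volume.restrict Ω)) :
    AEStronglyMeasurable (fun x => flux p q μ x (u x)) (volume.restrict Ω) := by
  have hrpow : ∀ e, AEMeasurable e (volume.restrict Ω) →
      AEStronglyMeasurable (fun x => rpowFlux (e x) (u x)) (volume.restrict Ω) := fun e he =>
    (hu.norm.aemeasurable.pow (he.sub_const 2)).aestronglyMeasurable.smul hu
  exact (hrpow p h.aemeasurable_p).add
    (h.integrableOn_μ.aestronglyMeasurable.smul (hrpow q h.aemeasurable_q))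

end Condition

end Measurability

theorem hasFDerivAt_of_continuousAt_subgradient {E : Type*} [NormedAddCommGroup E]
    [NormedSpace ℝ E] {f : E → ℝ} {A : E → StrongDual ℝ E} {u : E} (hA : ContinuousAt A u)
    (hf : ∀ u w, A u (w - u) ≤ f w - f u) : HasFDerivAt f (A u) u := by
  rw [hasFDerivAt_iff_isLittleO, Asymptotics.isLittleO_iff]
  intro c hc
  filter_upwards [Metric.continuousAt_iff'.1 hA c hc] with w hw
  rw [dist_eq_norm] at hw
  have lower := hf u w
  have upper : f w - f u ≤ A w (w - u) := by
    have := hf w u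
    rw [← neg_sub w u, map_neg] at this
    linarith
  have gap : A w (w - u) - A u (w - u) ≤ c * ‖w - u‖ :=
    calc (A w - A u) (w - u) ≤ ‖A w - A u‖ * ‖w - u‖ :=
          (le_abs_self _).trans ((A w - A u).le_opNorm _)
      _ ≤ c * ‖w - u‖ := by gcongr
  rw [Real.norm_of_nonneg (by linarith)]
  linarith

namespace LH

section Modular

variable {N : ℕ} {Ω : Set (EuclideanSpace ℝ (Fin N))} {p q μ : EuclideanSpace ℝ (Fin N) → ℝ}
  {h : Condition Ω p q μ} {F : Type*} [NormedAddCommGroup F] [NormedSpace ℝ F]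

/-- The modular `ρ_H(u)` as a real number. No information is lost, since it is finite on `LH h F`
(`LH.integrableOn_phaseFun`): the exponents are bounded. -/
noncomputable def realModular (u : LH h F) : ℝ :=
  ∫ x in Ω, phaseFun p q μ x ‖u.1 x‖

theorem integrableOn_phaseFun (u : LH h F) :
    IntegrableOn (fun x => phaseFun p q μ x ‖u.1 x‖) Ω := by
  obtain ⟨a, b, ha, hab⟩ := h.exists_exponent_bounds
  obtain ⟨α, hα, hfin⟩ := u.2
  have hαu : IntegrableOn (fun x => phaseFun p q μ x ‖α • u.1 x‖) Ω := by
    refine ⟨(h.aemeasurable_phaseFun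
      (u.1.aestronglyMeasurable.const_smul α)).aestronglyMeasurable, ?_⟩
    rw [hasFiniteIntegral_iff_ofReal]
    · exact hfin
    · filter_upwards [h.ae_bounds] with x hx using Condition.phaseFun_nonneg hx (norm_nonneg _)
  refine (hαu.const_mul (max 1 α⁻¹ ^ b)).mono'
    (h.aemeasurable_phaseFun u.1.aestronglyMeasurable).aestronglyMeasurable ?_
  filter_upwards [h.ae_bounds, hab] with x hx ⟨hp, hq⟩
  have ha0 : 0 ≤ a := zero_le_one.trans ha.le
  have hscale := phaseFun_mul_le (Icc_subset_Icc_left ha0 hp) (Icc_subset_Icc_left ha0 hq) hx.2.2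
    (inv_nonneg.2 hα.le) (norm_nonneg (α • u.1 x))
  rw [norm_smul, Real.norm_of_nonneg hα.le, inv_mul_cancel_left₀ hα.ne'] at hscale
  rwa [Real.norm_of_nonneg (Condition.phaseFun_nonneg hx (norm_nonneg _)), norm_smul,
    Real.norm_of_nonneg hα.le]

theorem realModular_nonneg (u : LH h F) : 0 ≤ realModular u :=
  integral_nonneg_of_ae <| by
    filter_upwards [h.ae_bounds] with x hx using Condition.phaseFun_nonneg hx (norm_nonneg _)

theorem ofReal_realModular (u : LH h F) :
    ENNReal.ofReal (realModular u) = modular Ω p q μ u.1 :=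
  ofReal_integral_eq_lintegral_ofReal (integrableOn_phaseFun u) <| by
    filter_upwards [h.ae_bounds] with x hx using Condition.phaseFun_nonneg hx (norm_nonneg _)

theorem realModular_le_of_modular_inv_smul_le {u : LH h F} {τ : ℝ} (hτ : 0 < τ) (hτ1 : τ ≤ 1)
    (hu : modular Ω p q μ (fun x => τ⁻¹ • u.1 x) ≤ 1) : realModular u ≤ τ := by
  have hscale := h.modular_smul_le (fun x => τ⁻¹ • u.1 x) hτ.le hτ1
  simp only [smul_inv_smul₀ hτ.ne'] at hscale
  rw [← ENNReal.ofReal_le_ofReal_iff hτ.le, ofReal_realModular]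
  exact hscale.trans (mul_le_of_le_one_right' hu)

theorem realModular_le_norm {u : LH h F} (hu : ‖u‖ < 1) : realModular u ≤ ‖u‖ := by
  have hne := h.luxNorm_set_nonempty u.2
  obtain ⟨σ, ⟨hσ, hσu⟩, hσ1⟩ := exists_lt_of_csInf_lt hne hu
  refine le_csInf hne fun τ ⟨hτ, hτu⟩ => ?_
  rcases le_total τ 1 with hτ1 | hτ1
  · exact realModular_le_of_modular_inv_smul_le hτ hτ1 hτu
  · exact (realModular_le_of_modular_inv_smul_le hσ hσ1.le hσu).trans (hσ1.le.trans hτ1)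

theorem realModular_le_one_of_mem_closedBall {v : LH h F}
    (hv : v ∈ Metric.closedBall (0 : LH h F) 2⁻¹) : realModular v ≤ 1 := by
  have hv' : ‖v‖ ≤ 2⁻¹ := mem_closedBall_zero_iff.1 hv
  exact (realModular_le_norm (by linarith)).trans (by linarith)

theorem coeFn_sub (u v : LH h F) : (u - v).1 =ᵐ[volume.restrict Ω] fun x => u.1 x - v.1 x :=
  AEEqFun.coeFn_sub u.1 v.1

end Modular

section Energy

variable {N : ℕ} {Ω : Set (EuclideanSpace ℝ (Fin N))} {p q μ : EuclideanSpace ℝ (Fin N) → ℝ}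
  {h : Condition Ω p q μ} {F : Type*} [NormedAddCommGroup F]

theorem integrableOn_energyDensity [NormedSpace ℝ F] (u : LH h F) :
    IntegrableOn (fun x => energyDensity p q μ x ‖u.1 x‖) Ω := by
  refine (integrableOn_phaseFun u).mono'
    (h.aemeasurable_energyDensity u.1.aestronglyMeasurable).aestronglyMeasurable ?_
  filter_upwards [h.ae_bounds] with x hx
  rw [Real.norm_of_nonneg (energyDensity_nonneg hx (norm_nonneg _))]
  exact energyDensity_le_phaseFun hx (norm_nonneg _)

/-- The double phase energy of a vector field `u ∈ L^H(Ω; F)`; the energy of the theorem is its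
composition with the weak gradient. -/
noncomputable def energy [NormedSpace ℝ F] (u : LH h F) : ℝ :=
  ∫ x in Ω, energyDensity p q μ x ‖u.1 x‖

variable [InnerProductSpace ℝ F]

theorem integrableOn_inner_flux (u v : LH h F) :
    IntegrableOn (fun x => inner ℝ (flux p q μ x (u.1 x)) (v.1 x)) Ω := by
  refine ((integrableOn_phaseFun u).add (integrableOn_phaseFun v)).mono'
    ((h.aestronglyMeasurable_flux u.1.aestronglyMeasurable).inner v.1.aestronglyMeasurable) ?_
  filter_upwards [h.ae_bounds] with x hx using abs_inner_flux_le hx _ _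

/-- The functional `v ↦ ∫_Ω flux(u) · v`, before its continuity is known. -/
noncomputable def fluxPairing (u : LH h F) : LH h F →ₗ[ℝ] ℝ where
  toFun v := ∫ x in Ω, inner ℝ (flux p q μ x (u.1 x)) (v.1 x)
  map_add' v w := by
    rw [← integral_add (integrableOn_inner_flux u v) (integrableOn_inner_flux u w)]
    refine integral_congr_ae ?_
    filter_upwards [AEEqFun.coeFn_add v.1 w.1] with x hx
    rw [← inner_add_right]
    exact congrArg _ hx
  map_smul' c v := by
    rw [RingHom.id_apply, smul_eq_mul, ← integral_const_mul]
    refine integral_congr_ae ?_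
    filter_upwards [AEEqFun.coeFn_smul c v.1] with x hx
    rw [← real_inner_smul_right]
    exact congrArg _ hx

theorem abs_fluxPairing_le (u v : LH h F) :
    |fluxPairing u v| ≤ realModular u + realModular v :=
  calc |fluxPairing u v| ≤ ∫ x in Ω, |inner ℝ (flux p q μ x (u.1 x)) (v.1 x)| :=
        abs_integral_le_integral_abs
    _ ≤ ∫ x in Ω, (phaseFun p q μ x ‖u.1 x‖ + phaseFun p q μ x ‖v.1 x‖) := by
        refine integral_mono_ae (integrableOn_inner_flux u v).abs
          ((integrableOn_phaseFun u).add (integrableOn_phaseFun v)) ?_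
        filter_upwards [h.ae_bounds] with x hx using abs_inner_flux_le hx _ _
    _ = realModular u + realModular v :=
        integral_add (integrableOn_phaseFun u) (integrableOn_phaseFun v)

/-- The functional `v ↦ ∫_Ω flux(u) · v` in the dual of `L^H(Ω; F)`; it is the derivative of
`LH.energy` at `u` (`LH.hasFDerivAt_energy`). -/
noncomputable def energyDeriv (u : LH h F) : StrongDual ℝ (LH h F) :=
  (fluxPairing u).mkContinuous ((realModular u + 1) / 2⁻¹) <|
    LinearMap.bound_of_ball_bound' (by norm_num) _ (fluxPairing u) fun v hv =>
      (abs_fluxPairing_le u v).trans <|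
        add_le_add_right (realModular_le_one_of_mem_closedBall hv) _

theorem energyDeriv_apply (u v : LH h F) :
    energyDeriv u v = ∫ x in Ω, inner ℝ (flux p q μ x (u.1 x)) (v.1 x) :=
  rfl

theorem energyDeriv_sub_apply (u w v : LH h F) : (energyDeriv w - energyDeriv u) v =
    ∫ x in Ω, inner ℝ (flux p q μ x (w.1 x) - flux p q μ x (u.1 x)) (v.1 x) := by
  simp only [inner_sub_left]
  exact (integral_sub (integrableOn_inner_flux w v) (integrableOn_inner_flux u v)).symm

variable (h F)

theorem exists_abs_energyDeriv_sub_apply_le {ε : ℝ} (hε : 0 < ε) :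
    ∃ C : ℝ, 0 ≤ C ∧ ∀ u w v : LH h F, |(energyDeriv w - energyDeriv u) v| ≤
      ε * (realModular u + realModular v) + C * realModular (w - u) := by
  obtain ⟨a, b, ha, hab⟩ := h.exists_exponent_bounds
  obtain ⟨C, hC, hflux⟩ := exists_abs_inner_flux_sub_le (N := N) F ha b hε
  refine ⟨C, hC, fun u w v => ?_⟩
  have hu := integrableOn_phaseFun u
  have hv := integrableOn_phaseFun v
  have hwu := integrableOn_phaseFun (w - u)
  have huv : IntegrableOn
      (fun x => ε * (phaseFun p q μ x ‖u.1 x‖ + phaseFun p q μ x ‖v.1 x‖)) Ω :=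
    (hu.add hv).const_mul ε
  calc |(energyDeriv w - energyDeriv u) v|
      ≤ ∫ x in Ω, |inner ℝ (flux p q μ x (w.1 x) - flux p q μ x (u.1 x)) (v.1 x)| := by
        rw [energyDeriv_sub_apply]
        exact abs_integral_le_integral_abs
    _ ≤ ∫ x in Ω, (ε * (phaseFun p q μ x ‖u.1 x‖ + phaseFun p q μ x ‖v.1 x‖) +
          C * phaseFun p q μ x ‖(w - u).1 x‖) := by
        refine integral_mono_of_nonneg (.of_forall fun _ => abs_nonneg _)
          (huv.add (hwu.const_mul C)) ?_
        filter_upwards [h.ae_bounds, hab, coeFn_sub w u] with x hx ⟨hp, hq⟩ hsub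
        rw [hsub]
        exact hflux p q μ x hp hq hx.2.2 _ _ _
    _ = ε * (realModular u + realModular v) + C * realModular (w - u) := by
        rw [integral_add huv (hwu.const_mul C), integral_const_mul,
          integral_const_mul, integral_add hu hv]
        rfl

theorem exists_norm_energyDeriv_sub_le {ε : ℝ} (hε : 0 < ε) :
    ∃ C : ℝ, 0 ≤ C ∧ ∀ u w : LH h F, ‖w - u‖ < 1 →
      ‖energyDeriv w - energyDeriv u‖ ≤ ε * (realModular u + 1) + C * ‖w - u‖ := by
  obtain ⟨C, hC, happly⟩ := exists_abs_energyDeriv_sub_apply_le h F (half_pos hε)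
  refine ⟨2 * C, by positivity, fun u w hwu => ?_⟩
  have hball : ∀ v ∈ Metric.closedBall (0 : LH h F) 2⁻¹, ‖(energyDeriv w - energyDeriv u) v‖ ≤
      ε / 2 * (realModular u + 1) + C * ‖w - u‖ := fun v hv => by
    refine (happly u w v).trans ?_
    gcongr
    · exact realModular_le_one_of_mem_closedBall hv
    · exact realModular_le_norm hwu
  refine (ContinuousLinearMap.opNorm_bound_of_ball_bound (by norm_num) _ _ hball).trans_eq ?_
  rw [div_inv_eq_mul]
  ring

variable {h F}

theorem continuous_energyDeriv : Continuous (energyDeriv : LH h F → StrongDual ℝ (LH h F)) := by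
  refine continuous_iff_continuousAt.2 fun u => Metric.continuousAt_iff.2 fun ε hε => ?_
  have hM : 0 < realModular u + 1 := add_pos_of_nonneg_of_pos (realModular_nonneg u) one_pos
  obtain ⟨C, hC, hdiff⟩ :=
    exists_norm_energyDeriv_sub_le h F (ε := ε / 2 / (realModular u + 1)) (by positivity)
  refine ⟨min 1 (ε / 2 / (C + 1)), by positivity, fun {w} hw => ?_⟩
  rw [dist_eq_norm, lt_min_iff, lt_div_iff₀ (by positivity)] at hw
  rw [dist_eq_norm]
  have hbound := hdiff u w hw.1
  rw [div_mul_cancel₀ _ hM.ne'] at hbound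
  linarith [norm_nonneg (w - u)]

theorem energyDeriv_apply_sub_le (u w : LH h F) :
    energyDeriv u (w - u) ≤ energy w - energy u := by
  have hw := integrableOn_energyDensity w
  have hu := integrableOn_energyDensity u
  rw [energyDeriv_apply, energy, energy, ← integral_sub hw hu]
  refine integral_mono_ae (integrableOn_inner_flux u (w - u)) (hw.sub hu) ?_
  filter_upwards [h.ae_bounds, coeFn_sub w u] with x hx hsub
  rw [hsub]
  exact inner_flux_sub_le hx _ _

theorem hasFDerivAt_energy (u : LH h F) : HasFDerivAt energy (energyDeriv u) u :=
  hasFDerivAt_of_continuousAt_subgradient continuous_energyDeriv.continuousAt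
    energyDeriv_apply_sub_le

end Energy

end LH

section Gradient

variable {N : ℕ} {Ω : Set (EuclideanSpace ℝ (Fin N))} {p q μ : EuclideanSpace ℝ (Fin N) → ℝ}

/-- The weak gradient as a continuous linear map `W₀^{1,H}(Ω) → L^H(Ω; ℝ^N)`. -/
noncomputable def gradL (h : Condition Ω p q μ) :
    W01H h →L[ℝ] LH h (EuclideanSpace ℝ (Fin N)) :=
  WithLp.sndL 1 ℝ (LH h ℝ) (LH h (EuclideanSpace ℝ (Fin N))) ∘L (W1H h).subtypeL ∘L
    (W01H h).subtypeL

theorem operatorIntegrand_eq_inner_flux {h : Condition Ω p q μ} (u v : W01H h) :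
    operatorIntegrand u v =
      fun x => inner ℝ (flux p q μ x ((gradL h u).1 x)) ((gradL h v).1 x) := by
  funext x
  simp only [inner_flux, rpowFlux, real_inner_smul_left]
  rfl

end Gradient

end DoublePhase

theorem mainTheorem12_general {N : ℕ} {Ω : Set (EuclideanSpace ℝ (Fin N))}
    {p q μ : EuclideanSpace ℝ (Fin N) → ℝ} (h : DoublePhase.Condition Ω p q μ)
    {F : Type*} [NormedAddCommGroup F] [InnerProductSpace ℝ F]
    {V : Type*} [NormedAddCommGroup V] [NormedSpace ℝ V] (D : V →L[ℝ] DoublePhase.LH h F) :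
    (∀ u, IntegrableOn (fun x => DoublePhase.energyDensity p q μ x ‖(D u).1 x‖) Ω) ∧
    ContDiff ℝ 1 (fun u => ∫ x in Ω, DoublePhase.energyDensity p q μ x ‖(D u).1 x‖) ∧
    ∃ A : V → StrongDual ℝ V,
      (∀ u v,
        IntegrableOn (fun x => inner ℝ (DoublePhase.flux p q μ x ((D u).1 x)) ((D v).1 x)) Ω ∧
        A u v = ∫ x in Ω, inner ℝ (DoublePhase.flux p q μ x ((D u).1 x)) ((D v).1 x)) ∧
      ∀ u, HasFDerivAt (fun u => ∫ x in Ω, DoublePhase.energyDensity p q μ x ‖(D u).1 x‖)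
        (A u) u := by
  have hderiv (u : V) : HasFDerivAt (fun u => DoublePhase.LH.energy (D u))
      ((DoublePhase.LH.energyDeriv (D u)).comp D) u :=
    (DoublePhase.LH.hasFDerivAt_energy (D u)).comp u D.hasFDerivAt
  have hcont : Continuous fun u => (DoublePhase.LH.energyDeriv (D u)).comp D :=
    (DoublePhase.LH.continuous_energyDeriv.comp D.continuous).clm_comp continuous_const
  exact ⟨fun u => DoublePhase.LH.integrableOn_energyDensity (D u),
    contDiff_one_iff_hasFDerivAt.2 ⟨_, hcont, hderiv⟩, _,
    fun u v => ⟨DoublePhase.LH.integrableOn_inner_flux (D u) (D v), rfl⟩, hderiv⟩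

theorem mainTheorem12 {N : ℕ} {Ω : Set (EuclideanSpace ℝ (Fin N))}
    {p q μ : EuclideanSpace ℝ (Fin N) → ℝ} (h : DoublePhase.Condition Ω p q μ) :
    (∀ u : DoublePhase.W01H h, IntegrableOn (DoublePhase.energyIntegrand u) Ω) ∧
    ContDiff ℝ 1 (DoublePhase.energy h) ∧
    ∃ A : DoublePhase.W01H h → StrongDual ℝ (DoublePhase.W01H h),
      DoublePhase.IsDoublePhaseOperator h A ∧
      ∀ u, HasFDerivAt (DoublePhase.energy h) (A u) u := by
  simp only [DoublePhase.IsDoublePhaseOperator, DoublePhase.operatorIntegrand_eq_inner_flux]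
  -- Elaborating `mainTheorem12_general h (gradL h)` unifies the instance arguments to a form of the
  -- norm on `W01H h` at which `NormedSpace` is no longer found, so they are given explicitly.
  exact @mainTheorem12_general _ _ _ _ _ h _ _ _ (DoublePhase.W01H h)
    (Submodule.normedAddCommGroup _) (Submodule.normedSpace _) (DoublePhase.gradL h)
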